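/- Let $D\subset\mathbb R^d$ be a bounded domain. Let $\mathcal L$ be a densely defined, linear, self-adjoint, positive (possibly unbounded) operator on $L^2(D)$ with compact inverse. Let $(e_j)_{j\ge1}$ be an orthonormal basis of $L^2(D)$ with $\mathcal L e_j=\lambda_j e_j$, where $0<\lambda_1\le\lambda_2\le\dots$ and $\lambda_j\to\infty$. For $s>0$ let $$\mathcal H^s=\Big\{v\in L^2(D):\ \|v\|_{\mathcal H^s}^2:=\sum_{j}\lambda_j^{2s}\langle v,e_j\rangle^2<\infty\Big\}.$$ Let $T>0$ and let $W$ be an $L^2(D)$-valued $Q$-Wiener process on $[0,T]$ on a probability space $(\Omega,\mathcal F,\mathbb P)$, adapted to a normal filtration $(\mathcal F_t)$. Here $Q$ is a bounded, self-adjoint, positive semidefinite operator of finite trace with $Qe_j=\mu_je_j$. Write $W(t)=\sum_j\sqrt{\mu_j}\,B_j(t)\,e_j$ with Brownian motions $B_j$ (that is, $\sqrt{\mu_j}\,B_j=\langle W,e_j\rangle$). Let $s>0$ and suppose that $\sum_j\lambda_j^{-s}<\infty$ and that, for some $\varepsilon\ge0$, $\mu_j\sim\lambda_j^{-2s-\varepsilon}$,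 in the sense that for all large $j$ the two sequences are comparable up to positive constants. Let $y_0\in L^2(D)$ be deterministic. A solution of the state equation $$dy(t)+\mathcal L^s y(t)\,dt=dW(t),\qquad y(0)=y_0,$$ on $[0,T]$ is an adapted $L^2(D)$-valued process $y$ such that, for every $t\in[0,T]$, $y(t)=\sum_j y_j(t)\,e_j$ almost surely, where the real processes $y_j$ are strong solutions on $[0,T]$ of the Itô equations $$dy_j(t)=-\lambda_j^s\,y_j(t)\,dt+\sqrt{\mu_j}\,dB_j(t),\qquad y_j(0)=\langle y_0,e_j\rangle .$$ Then the state equation has a solution, and every solution $y$ satisfies $$y(t)\in L^2(\Omega,\mathcal H^s)\qquad\text{for every } t\in(0,T].$$ -/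

import Mathlib

open MeasureTheory ProbabilityTheory Filter Set
open scoped Topology NNReal ENNReal InnerProductSpace

noncomputable section

namespace FracSPDE

/-- The real Hilbert space `L²(D)`. -/
abbrev L2 {E : Type*} [MeasureSpace E] (D : Set E) : Type _ :=
  Lp ℝ 2 ((volume : Measure E).restrict D)

/-- `L²(D)` carries its Borel σ-algebra. -/
instance {E : Type*} [MeasureSpace E] (D : Set E) : MeasurableSpace (L2 D) := borel _

instance {E : Type*} [MeasureSpace E] (D : Set E) : BorelSpace (L2 D) := ⟨rfl⟩

/-- A bounded domain: bounded, open, connected (in particular nonempty). -/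
structure IsBoundedDomain {E : Type*} [NormedAddCommGroup E] (D : Set E) : Prop where
  isOpen : IsOpen D
  isConnected : IsConnected D
  isBounded : Bornology.IsBounded D

section Hilbert

variable {H : Type*} [NormedAddCommGroup H] [InnerProductSpace ℝ H]

/-- A densely defined, self-adjoint, positive (possibly unbounded) linear operator with a
compact inverse. -/
structure IsPosSelfAdjointCompactInv [CompleteSpace H] (L : H →ₗ.[ℝ] H) : Prop where
  dense : Dense (L.domain : Set H)
  selfAdjoint : IsSelfAdjoint L
  nonneg : ∀ x : L.domain, 0 ≤ ⟪L x, (x : H)⟫_ℝ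
  compactInverse : ∃ K : H →L[ℝ] H, IsCompactOperator K ∧
    (∀ x : H, ∃ hx : K x ∈ L.domain, L ⟨K x, hx⟩ = x) ∧ ∀ x : L.domain, K (L x) = x

/-- An orthonormal basis of eigenvectors of `L`, with
`0 < λ_0 ≤ λ_1 ≤ …` and `λ_j → ∞` (indices start at `0`). -/
structure EigenSystem (L : H →ₗ.[ℝ] H) where
  e : HilbertBasis ℕ ℝ H
  lam : ℕ → ℝ
  mem_domain : ∀ j, e j ∈ L.domain
  eigen : ∀ j, L ⟨e j, mem_domain j⟩ = lam j • e j
  lam_zero_pos : 0 < lam 0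
  lam_mono : Monotone lam
  lam_tendsto : Tendsto lam atTop atTop

lemma EigenSystem.lam_pos {L : H →ₗ.[ℝ] H} (S : EigenSystem L) (j : ℕ) : 0 < S.lam j :=
  S.lam_zero_pos.trans_le (S.lam_mono (Nat.zero_le j))

/-- The subspace `{v : ∑ λ_j^{2s} ⟨v, e_j⟩² < ∞}` of `H`. -/
def hsSubmodule {L : H →ₗ.[ℝ] H} (S : EigenSystem L) (s : ℝ) : Submodule ℝ H where
  carrier := {v | Summable fun j => S.lam j ^ (2 * s) * ⟪v, S.e j⟫_ℝ ^ 2}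
  zero_mem' := by simp
  add_mem' := by
    intro v w hv hw
    refine Summable.of_nonneg_of_le (fun j => ?_) (fun j => ?_)
      ((Summable.mul_left 2 hv).add (Summable.mul_left 2 hw))
    · have := Real.rpow_nonneg (S.lam_pos j).le (2 * s)
      positivity
    · have := Real.rpow_nonneg (S.lam_pos j).le (2 * s)
      rw [inner_add_left]
      nlinarith [mul_nonneg this (sq_nonneg (⟪v, S.e j⟫_ℝ - ⟪w, S.e j⟫_ℝ))]
  smul_mem' := by
    intro c v hv
    refine (Summable.mul_left (c ^ 2) hv).congr (fun j => ?_)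
    rw [real_inner_smul_left]
    ring

/-- The space `ℋ^s`: its vectors are those of `hsSubmodule S s`; its norm, given below, is
`(∑ λ_j^{2s} ⟨v, e_j⟩²)^{1/2}` and not the norm inherited from `H`. -/
def Hs {L : H →ₗ.[ℝ] H} (S : EigenSystem L) (s : ℝ) : Type _ := hsSubmodule S s

namespace Hs

variable {L : H →ₗ.[ℝ] H} {S : EigenSystem L} {s : ℝ}

instance : AddCommGroup (Hs S s) := inferInstanceAs (AddCommGroup (hsSubmodule S s))

instance : Module ℝ (Hs S s) := inferInstanceAs (Module ℝ (hsSubmodule S s))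

/-- The inclusion `ℋ^s → H`. -/
def incl : Hs S s →ₗ[ℝ] H := (hsSubmodule S s).subtype

lemma incl_injective : Function.Injective (incl : Hs S s → H) := Subtype.val_injective

lemma summable_coord (v : Hs S s) :
    Summable fun j => S.lam j ^ (2 * s) * ⟪incl v, S.e j⟫_ℝ ^ 2 := v.2

lemma coord_sq (v : Hs S s) (j : ℕ) :
    (S.lam j ^ s * ⟪incl v, S.e j⟫_ℝ) ^ 2 = S.lam j ^ (2 * s) * ⟪incl v, S.e j⟫_ℝ ^ 2 := by
  rw [mul_pow, mul_comm 2 s, Real.rpow_mul (S.lam_pos j).le, Real.rpow_two]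

/-- The map `v ↦ (λ_j^s ⟨v, e_j⟩)_j` from `ℋ^s` to `ℓ²`. -/
def coord : Hs S s →ₗ[ℝ] lp (fun _ : ℕ => ℝ) 2 where
  toFun v := ⟨fun j => S.lam j ^ s * ⟪incl v, S.e j⟫_ℝ, by
    refine memℓp_gen ((summable_coord v).congr fun j => ?_)
    rw [← coord_sq, ENNReal.toReal_ofNat, Real.rpow_two, Real.norm_eq_abs, sq_abs]⟩
  map_add' v w := by
    ext j
    change S.lam j ^ s * ⟪incl (v + w), S.e j⟫_ℝ =
      S.lam j ^ s * ⟪incl v, S.e j⟫_ℝ + S.lam j ^ s * ⟪incl w, S.e j⟫_ℝ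
    rw [map_add, inner_add_left, mul_add]
  map_smul' c v := by
    ext j
    change S.lam j ^ s * ⟪incl (c • v), S.e j⟫_ℝ = c * (S.lam j ^ s * ⟪incl v, S.e j⟫_ℝ)
    rw [map_smul, real_inner_smul_left]
    ring

lemma coord_apply (v : Hs S s) (j : ℕ) :
    coord v j = S.lam j ^ s * ⟪incl v, S.e j⟫_ℝ := rfl

lemma coord_injective : Function.Injective (coord : Hs S s → lp (fun _ : ℕ => ℝ) 2) := by
  intro v w h
  apply incl_injective
  apply S.e.repr.injective
  ext j
  have h1 : coord v j = coord w j := by rw [h]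
  rw [coord_apply, coord_apply] at h1
  have h2 := mul_left_cancel₀ (Real.rpow_pos_of_pos (S.lam_pos j) s).ne' h1
  rw [HilbertBasis.repr_apply_apply, HilbertBasis.repr_apply_apply, real_inner_comm, h2,
    real_inner_comm]

/-- The norm of `ℋ^s`, pulled back from `ℓ²` along `v ↦ (λ_j^s ⟨v, e_j⟩)_j`. -/
instance : NormedAddCommGroup (Hs S s) :=
  NormedAddCommGroup.induced (Hs S s) (lp (fun _ : ℕ => ℝ) 2) coord coord_injective

lemma norm_eq (v : Hs S s) :
    ‖v‖ = Real.sqrt (∑' j, S.lam j ^ (2 * s) * ⟪incl v, S.e j⟫_ℝ ^ 2) := by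
  have h : ‖v‖ = ‖coord v‖ := rfl
  rw [h, lp.norm_eq_tsum_rpow (by simp), Real.sqrt_eq_rpow]
  simp only [ENNReal.toReal_ofNat, Real.rpow_two, Real.norm_eq_abs, sq_abs, coord_apply, coord_sq]

end Hs

variable {Ω : Type*} {mΩ : MeasurableSpace Ω}

/-- `u ∈ L²(Ω, ℋ^s)`: almost surely, `u` is equal to a square-integrable random variable (in the
sense of Bochner) with values in the normed space `ℋ^s`. -/
def MemL2Hs {L : H →ₗ.[ℝ] H} (S : EigenSystem L) (s : ℝ) (P : Measure Ω) (u : Ω → H) : Prop :=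
  ∃ z : Ω → Hs S s, MemLp z 2 P ∧ ∀ᵐ ω ∂P, Hs.incl (z ω) = u ω

/-- A covariance operator that is diagonal in the basis `e`, with eigenvalues `μ_j`: bounded,
linear, self-adjoint, positive semidefinite, of finite trace, and `Q e_j = μ_j e_j`. -/
structure IsDiagonalCovariance {L : H →ₗ.[ℝ] H} (S : EigenSystem L) (Q : H →L[ℝ] H)
    (mu : ℕ → ℝ) : Prop where
  isPositive : Q.IsPositive
  eigen : ∀ j, Q (S.e j) = mu j • S.e j
  trace : Summable fun j => ⟪Q (S.e j), S.e j⟫_ℝ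

/-- A normal filtration on `[0,T]`: it is right-continuous and `𝓕_0` contains all null events. -/
structure IsNormalFiltration (F : Filtration ℝ mΩ) (T : ℝ) (P : Measure Ω) : Prop where
  null : ∀ A : Set Ω, MeasurableSet A → P A = 0 → MeasurableSet[F 0] A
  rightCont : ∀ t ∈ Ico 0 T, (⨅ u ∈ Ioi t, F u) ≤ F t

/-- A `Q`-Wiener process on `[0,T]` with values in `H`: it starts at `0`, has continuous paths
almost surely, its increments are independent, and `W(t) - W(r)` is centered Gaussian with
covariance operator `(t - r) Q`. Only its values at times in `[0,T]` matter. -/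
structure IsQWiener [MeasurableSpace H] [BorelSpace H] (Q : H →L[ℝ] H) (T : ℝ) (P : Measure Ω)
    (W : ℝ → Ω → H) : Prop where
  zero : ∀ᵐ ω ∂P, W 0 ω = 0
  cont : ∀ᵐ ω ∂P, ContinuousOn (fun t => W t ω) (Icc 0 T)
  indep : HasIndepIncrements (fun (t : Icc (0 : ℝ) T) ω => W t ω) P
  gaussian : ∀ r ∈ Icc 0 T, ∀ t ∈ Icc 0 T, r ≤ t → ∀ h : H,
    HasLaw (fun ω => ⟪W t ω - W r ω, h⟫_ℝ) (gaussianReal 0 ((t - r) * ⟪Q h, h⟫_ℝ).toNNReal) P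

/-- The process `Z` is adapted to `F` on `[0,T]`. -/
def IsAdaptedOn {X : Type*} [TopologicalSpace X] (F : Filtration ℝ mΩ) (T : ℝ)
    (Z : ℝ → Ω → X) : Prop :=
  ∀ t ∈ Icc 0 T, StronglyMeasurable[F t] (Z t)

/-- The Brownian motions `B_j = μ_j^{-1/2} ⟨W, e_j⟩` (for `μ_j > 0`) in the expansion
`W(t) = ∑ μ_j^{1/2} B_j(t) e_j`. If `μ_j = 0`, this is `0`; that term then has coefficient `0`. -/
def brownianCoord {L : H →ₗ.[ℝ] H} (S : EigenSystem L) (mu : ℕ → ℝ) (W : ℝ → Ω → H) (j : ℕ) :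
    ℝ → Ω → ℝ :=
  fun t ω => (Real.sqrt (mu j))⁻¹ * ⟪W t ω, S.e j⟫_ℝ

/-- `Z` is a strong solution on `[0,T]` of the Itô equation
`dZ(t) = -a Z(t) dt + b dB(t)`, `Z(0) = z`, with constants `a`, `b`: it is adapted, has continuous
paths, and `Z(t) = z - ∫₀ᵗ a Z(τ) dτ + b B(t)`. (The coefficient of `dB` is constant and `B(0) = 0`,
so that the Itô integral `∫₀ᵗ b dB` is `b B(t)`.) -/
structure IsItoSolution (F : Filtration ℝ mΩ) (T : ℝ) (P : Measure Ω) (B : ℝ → Ω → ℝ)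
    (a b z : ℝ) (Z : ℝ → Ω → ℝ) : Prop where
  adapted : IsAdaptedOn F T Z
  equation : ∀ᵐ ω ∂P, ContinuousOn (fun t => Z t ω) (Icc 0 T) ∧
    ∀ t ∈ Icc 0 T, Z t ω = z - (∫ τ in (0 : ℝ)..t, a * Z τ ω) + b * B t ω

/-- `y` is a solution on `[0,T]` of the state equation `dy + 𝓛^s y dt = dW`, `y(0) = y₀`:
an adapted `H`-valued process with `y(t) = ∑ y_j(t) e_j`, where the real processes `y_j` solve
`dy_j = -λ_j^s y_j dt + μ_j^{1/2} dB_j`, `y_j(0) = ⟨y₀, e_j⟩`. -/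
structure IsSolution {L : H →ₗ.[ℝ] H} (S : EigenSystem L) (mu : ℕ → ℝ) (F : Filtration ℝ mΩ)
    (T : ℝ) (P : Measure Ω) (W : ℝ → Ω → H) (s : ℝ) (y₀ : H) (y : ℝ → Ω → H) : Prop where
  adapted : IsAdaptedOn F T y
  expansion : ∃ Y : ℕ → ℝ → Ω → ℝ,
    (∀ j, IsItoSolution F T P (brownianCoord S mu W j) (S.lam j ^ s) (Real.sqrt (mu j))
      ⟪y₀, S.e j⟫_ℝ (Y j)) ∧
    ∀ t ∈ Icc 0 T, ∀ᵐ ω ∂P, HasSum (fun j => Y j t ω • S.e j) (y t ω)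

/-- The decay assumption: `μ_j ∼ λ_j^{-2s-ε}` (the two sequences are comparable up to positive
constants for large `j`) and `∑ λ_j^{-s} < ∞`. -/
structure DecayAssumption {L : H →ₗ.[ℝ] H} (S : EigenSystem L) (mu : ℕ → ℝ) (s ε : ℝ) :
    Prop where
  comparable : mu =Θ[atTop] fun j => S.lam j ^ (-2 * s - ε)
  summable : Summable fun j => S.lam j ^ (-s)

end Hilbert

end FracSPDE

end

/-! In the eigenbasis the equation decouples: `y_j` is an Ornstein–Uhlenbeck process with rate `a =
λ_j^s`, noise variance `μ_j` and start `z = ⟨y₀, e_j⟩`. The key estimate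
(`IsItoSolution.lintegral_sq_le`) is `E y_j(t)² ≤ 3 (e^{-2at} z² + 2 μ_j / a)`. Multiply it by
`λ_j^{2s} = a²`. The initial part is at most a constant times `z² / t²`, because `a e^{-at} ≤ 1/t`;
this smoothing is why `y₀` needs no regularity and why `t > 0`. The noise part is of order `a μ_j ∼
λ_j^{-s-ε}`, hence summable. Tonelli then bounds `E ‖y(t)‖²` in `ℋ^s`.

No stochastic integral is needed. The noise is additive, so the scalar equation is solved path by
path (`ouPath`, unique by `eq_ouPath`). Integration by parts expresses the solution through
increments `w(t) - w(r)` against the kernel `a e^{-a(t-r)}` (`ouPath_eq_increments`). The kernel has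
mass at most 1, so Jensen, Tonelli and `E (w(t) - w(r))² ≤ μ_j (t - r)` give the factor `1/a`.

For existence, the same bound without weights is summable because `Q` has finite trace and `λ_j^s ≥
λ_0^s`; the series of scalar solutions therefore converges almost surely. -/

namespace FracSPDE

/-- The solution `e^{-at} (z - ∫₀ᵗ a e^{ar} w(r) dr) + w(t)` of `Z(t) = z - ∫₀ᵗ a Z + w(t)`. -/
noncomputable def ouPath (a z : ℝ) (w : ℝ → ℝ) (t : ℝ) : ℝ :=
  Real.exp (-(a * t)) * (z - ∫ r in (0 : ℝ)..t, a * Real.exp (a * r) * w r) + w t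

/-! ### The scalar equation with a fixed continuous driving path. -/

section Path

variable {a z T : ℝ} {w Z : ℝ → ℝ}

lemma hasDerivAt_integral_of_continuous {f : ℝ → ℝ} (hf : Continuous f) (t : ℝ) :
    HasDerivAt (fun u => ∫ x in (0 : ℝ)..u, f x) (f t) t :=
  intervalIntegral.integral_hasDerivAt_right (hf.intervalIntegrable _ _)
    hf.aestronglyMeasurable.stronglyMeasurableAtFilter hf.continuousAt

lemma hasDerivAt_exp_const_mul (a t : ℝ) :
    HasDerivAt (fun u => Real.exp (a * u)) (a * Real.exp (a * t)) t := by
  have h := ((hasDerivAt_id t).const_mul a).exp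
  simpa [mul_comm] using h

lemma hasDerivAt_exp_neg_const_mul (a t : ℝ) :
    HasDerivAt (fun u => Real.exp (-(a * u))) (-a * Real.exp (-(a * t))) t := by
  simpa [neg_mul] using hasDerivAt_exp_const_mul (-a) t

/-- Subtracting `w`, which need not be differentiable, leaves a differentiable function; integrating
its derivative yields the integral equation. -/
lemma hasDerivAt_ouPath_sub (hw : Continuous w) (t : ℝ) :
    HasDerivAt (fun u => ouPath a z w u - w u) (-(a * ouPath a z w t)) t := by
  have h := (hasDerivAt_exp_neg_const_mul a t).mul
    ((hasDerivAt_integral_of_continuous (f := fun r => a * Real.exp (a * r) * w r)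
      (by fun_prop) t).const_sub z)
  have e : Real.exp (-(a * t)) * Real.exp (a * t) = 1 := by rw [← Real.exp_add]; simp
  refine (h.congr_deriv ?_).congr_of_eventuallyEq (Eventually.of_forall fun u => ?_)
  · simp only [ouPath]
    linear_combination (-a * w t) * e
  · simp [ouPath]

lemma continuous_ouPath (hw : Continuous w) : Continuous (ouPath a z w) := by
  have h : Continuous fun u => ouPath a z w u - w u :=
    continuous_iff_continuousAt.2 fun t => (hasDerivAt_ouPath_sub hw t).continuousAt
  exact (h.add hw).congr fun u => by simp

lemma ouPath_equation (hw : Continuous w) (t : ℝ) :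
    ouPath a z w t = z - (∫ τ in (0 : ℝ)..t, a * ouPath a z w τ) + w t := by
  have hc : Continuous fun u => -(a * ouPath a z w u) := by
    have := continuous_ouPath (a := a) (z := z) hw
    fun_prop
  have h := intervalIntegral.integral_eq_sub_of_hasDerivAt (a := 0) (b := t)
    (fun u _ => hasDerivAt_ouPath_sub (a := a) (z := z) hw u) (hc.intervalIntegrable _ _)
  rw [intervalIntegral.integral_neg] at h
  have h0 : ouPath a z w 0 - w 0 = z := by simp [ouPath]
  linarith

/-- Uniqueness: the difference `D` of two solutions satisfies `D = -a ∫ D`, so `e^{at} ∫ D` has zero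
derivative and vanishes at `0`. -/
lemma eq_ouPath (hw : Continuous w) (hZ : ContinuousOn Z (Icc 0 T))
    (h : ∀ t ∈ Icc 0 T, Z t = z - (∫ τ in (0 : ℝ)..t, a * Z τ) + w t) :
    ∀ t ∈ Icc 0 T, Z t = ouPath a z w t := by
  intro t₀ ht₀
  have hT : 0 ≤ T := ht₀.1.trans ht₀.2
  -- Freezing `Z` outside `[0,T]` makes `D` continuous on the whole line, so its integral is
  -- differentiable at the endpoints too.
  set D : ℝ → ℝ := fun t => Z (projIcc 0 T hT t) - ouPath a z w t with hD
  have hDc : Continuous D := by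
    refine Continuous.sub ?_ (continuous_ouPath hw)
    exact hZ.comp_continuous (continuous_subtype_val.comp continuous_projIcc) fun t => Subtype.prop _
  have hDZ : ∀ t ∈ Icc 0 T, D t = Z t - ouPath a z w t := by
    intro t ht
    simp only [hD, projIcc_of_mem hT ht]
  have hDeq : ∀ t ∈ Icc 0 T, D t = -(a * ∫ τ in (0 : ℝ)..t, D τ) := by
    intro t ht
    have hsub : uIcc 0 t ⊆ Icc 0 T := by
      rw [uIcc_of_le ht.1]
      exact Icc_subset_Icc_right ht.2
    have e1 : ∫ τ in (0 : ℝ)..t, D τ = ∫ τ in (0 : ℝ)..t, (Z τ - ouPath a z w τ) :=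
      intervalIntegral.integral_congr fun τ hτ => hDZ τ (hsub hτ)
    rw [e1, intervalIntegral.integral_sub ((hZ.mono hsub).intervalIntegrable)
      ((continuous_ouPath hw).intervalIntegrable _ _), hDZ t ht, h t ht]
    have h2 := ouPath_equation (a := a) (z := z) hw t
    rw [intervalIntegral.integral_const_mul] at h2 ⊢
    linarith
  have hder : ∀ t, HasDerivAt (fun u => Real.exp (a * u) * ∫ τ in (0 : ℝ)..u, D τ)
      (a * Real.exp (a * t) * (∫ τ in (0 : ℝ)..t, D τ) + Real.exp (a * t) * D t) t := fun t =>
    (hasDerivAt_exp_const_mul a t).mul (hasDerivAt_integral_of_continuous hDc t)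
  have hconst := constant_of_derivWithin_zero (a := 0) (b := T)
    (f := fun u => Real.exp (a * u) * ∫ τ in (0 : ℝ)..u, D τ)
    (fun t _ => (hder t).differentiableAt.differentiableWithinAt)
    (fun t ht => by
      rw [(hder t).hasDerivWithinAt.derivWithin
        (uniqueDiffOn_Icc (ht.1.trans_lt ht.2) t (Ico_subset_Icc_self ht)),
        hDeq t (Ico_subset_Icc_self ht)]
      ring) t₀ ht₀
  simp only [intervalIntegral.integral_same, mul_zero, mul_eq_zero, Real.exp_ne_zero,
    false_or] at hconst
  have := hDeq t₀ ht₀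
  rw [hconst, hDZ t₀ ht₀] at this
  linarith

lemma integral_expKernel (a t : ℝ) :
    ∫ r in (0 : ℝ)..t, a * Real.exp (a * r) * Real.exp (-(a * t)) = 1 - Real.exp (-(a * t)) := by
  rw [intervalIntegral.integral_eq_sub_of_hasDerivAt
    (f := fun r => Real.exp (a * r) * Real.exp (-(a * t)))
    (fun r _ => (hasDerivAt_exp_const_mul a r).mul_const _)
    (Continuous.intervalIntegrable (by fun_prop) _ _)]
  simp [← Real.exp_add]

lemma integral_expKernel_mul_sub_le (ha : 0 < a) {t : ℝ} (ht : 0 ≤ t) :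
    ∫ r in (0 : ℝ)..t, a * Real.exp (a * r) * Real.exp (-(a * t)) * (t - r) ≤ 1 / a := by
  -- This antiderivative equals `1/a` at `r = t` and is nonnegative at `r = 0`.
  rw [intervalIntegral.integral_eq_sub_of_hasDerivAt
    (f := fun r => Real.exp (a * r) * Real.exp (-(a * t)) * (t - r + 1 / a))
    (fun r _ => (((hasDerivAt_exp_const_mul a r).mul_const (Real.exp (-(a * t)))).mul
      (((hasDerivAt_id r).const_sub t).add_const (1 / a))).congr_deriv (by
        simp only [id]
        field_simp
        ring))
    (Continuous.intervalIntegrable (by fun_prop) _ _)]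
  have : 0 ≤ Real.exp (-(a * t)) * (t + 1 / a) := by positivity
  have e : Real.exp (a * t) * Real.exp (-(a * t)) = 1 := by rw [← Real.exp_add]; simp
  simp [e]
  simpa using this

/-- The cancellation between `w t` and the integral of `w r` becomes visible here: the kernel
concentrates near `r = t`, where the increment is small. -/
lemma ouPath_eq_increments (hw : Continuous w) (t : ℝ) :
    ouPath a z w t = Real.exp (-(a * t)) * z + Real.exp (-(a * t)) * w t +
      ∫ r in (0 : ℝ)..t, a * Real.exp (a * r) * Real.exp (-(a * t)) * (w t - w r) := by
  have h1 : ∫ r in (0 : ℝ)..t, a * Real.exp (a * r) * Real.exp (-(a * t)) * (w t - w r) =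
      (∫ r in (0 : ℝ)..t, a * Real.exp (a * r) * Real.exp (-(a * t)) * w t) -
      ∫ r in (0 : ℝ)..t, Real.exp (-(a * t)) * (a * Real.exp (a * r) * w r) := by
    rw [← intervalIntegral.integral_sub (Continuous.intervalIntegrable (by fun_prop) _ _)
      (Continuous.intervalIntegrable (by fun_prop) _ _)]
    congr 1
    ext r
    ring
  rw [h1, intervalIntegral.integral_mul_const, integral_expKernel,
    intervalIntegral.integral_const_mul, ouPath]
  ring

/-- Jensen for a kernel of mass at most 1: with `c = ∫ k u`, expand `0 ≤ ∫ k (u - c)²` to get `0 ≤ ∫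
k u² - 2c² + c² ∫ k`. -/
lemma sq_integral_mul_le {k u : ℝ → ℝ} {t : ℝ} (ht : 0 ≤ t) (hk : Continuous k) (hu : Continuous u)
    (hk0 : ∀ r, 0 ≤ k r) (hk1 : ∫ r in (0 : ℝ)..t, k r ≤ 1) :
    (∫ r in (0 : ℝ)..t, k r * u r) ^ 2 ≤ ∫ r in (0 : ℝ)..t, k r * u r ^ 2 := by
  set c := ∫ r in (0 : ℝ)..t, k r * u r with hc
  have h0 : 0 ≤ ∫ r in (0 : ℝ)..t, k r * (u r - c) ^ 2 :=
    intervalIntegral.integral_nonneg ht fun r _ => mul_nonneg (hk0 r) (sq_nonneg _)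
  have h1 : ∫ r in (0 : ℝ)..t, k r * (u r - c) ^ 2 =
      (∫ r in (0 : ℝ)..t, k r * u r ^ 2) - (∫ r in (0 : ℝ)..t, (2 * c) * (k r * u r)) +
        ∫ r in (0 : ℝ)..t, k r * c ^ 2 := by
    rw [← intervalIntegral.integral_sub (Continuous.intervalIntegrable (by fun_prop) _ _)
      (Continuous.intervalIntegrable (by fun_prop) _ _),
      ← intervalIntegral.integral_add (Continuous.intervalIntegrable (by fun_prop) _ _)
      (Continuous.intervalIntegrable (by fun_prop) _ _)]
    congr 1
    ext r
    ring
  rw [h1, intervalIntegral.integral_const_mul, intervalIntegral.integral_mul_const, ← hc] at h0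
  nlinarith [mul_le_mul_of_nonneg_right hk1 (sq_nonneg c)]

lemma sq_ouPath_le (ha : 0 < a) (hw : Continuous w) {t : ℝ} (ht : 0 ≤ t) :
    ouPath a z w t ^ 2 ≤ 3 * (Real.exp (-(a * t)) ^ 2 * z ^ 2 + Real.exp (-(a * t)) ^ 2 * w t ^ 2 +
      ∫ r in (0 : ℝ)..t, a * Real.exp (a * r) * Real.exp (-(a * t)) * (w t - w r) ^ 2) := by
  have h := sq_integral_mul_le (k := fun r => a * Real.exp (a * r) * Real.exp (-(a * t)))
    (u := fun r => w t - w r) ht (by fun_prop) (by fun_prop) (fun r => by positivity)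
    (by rw [integral_expKernel]; linarith [Real.exp_pos (-(a * t))])
  rw [ouPath_eq_increments hw]
  generalize (∫ r in (0 : ℝ)..t, a * Real.exp (a * r) * Real.exp (-(a * t)) * (w t - w r)) = X at *
  nlinarith [sq_nonneg (Real.exp (-(a * t)) * z - Real.exp (-(a * t)) * w t),
    sq_nonneg (Real.exp (-(a * t)) * z - X), sq_nonneg (Real.exp (-(a * t)) * w t - X)]

end Path

/-! ### Second moments, measurability and continuous modifications. -/

section Noise

variable {Ω : Type*} {mΩ : MeasurableSpace Ω} {P : Measure Ω}

lemma mul_sq_exp_neg_le {a t : ℝ} (ha : 0 < a) (ht : 0 ≤ t) :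
    Real.exp (-(a * t)) ^ 2 * t ≤ 1 / a := by
  have h1 : a * t ≤ Real.exp (a * t) := by linarith [Real.add_one_le_exp (a * t)]
  have e : Real.exp (a * t) * Real.exp (-(a * t)) = 1 := by rw [← Real.exp_add]; simp
  have h2 : Real.exp (-(a * t)) ≤ 1 := Real.exp_le_one_iff.2 (by nlinarith)
  have h3 : a * t * Real.exp (-(a * t)) ≤ 1 := by
    rw [← e]
    exact mul_le_mul_of_nonneg_right h1 (Real.exp_pos _).le
  rw [le_div_iff₀ ha]
  nlinarith [Real.exp_pos (-(a * t))]

/-- Tonelli moves the expectation inside the time integral, where the increment bound leaves the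
first moment of the kernel, at most `1/a`. -/
lemma lintegral_weighted_increments_le [SFinite P] {g : ℝ → Ω → ℝ}
    (hc : ∀ ω, Continuous fun t => g t ω)
    (hm : ∀ t, Measurable (g t)) {a m t : ℝ} (ha : 0 < a) (hm0 : 0 ≤ m) (ht : 0 ≤ t)
    (hinc : ∀ r ∈ Icc 0 t, ∫⁻ ω, ENNReal.ofReal ((g t ω - g r ω) ^ 2) ∂P ≤
      ENNReal.ofReal (m * (t - r))) :
    ∫⁻ ω, ENNReal.ofReal (∫ r in (0 : ℝ)..t,
      a * Real.exp (a * r) * Real.exp (-(a * t)) * (g t ω - g r ω) ^ 2) ∂P ≤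
      ENNReal.ofReal (m / a) := by
  have hjm : Measurable (Function.uncurry g) := measurable_uncurry_of_continuous_of_measurable hc hm
  have hjm' : Measurable fun p : Ω × ℝ => g p.2 p.1 := hjm.comp measurable_swap
  have hk : ∀ r, 0 ≤ a * Real.exp (a * r) * Real.exp (-(a * t)) := fun r => by positivity
  calc _ = ∫⁻ ω, (∫⁻ r in Ioc 0 t, ENNReal.ofReal
        (a * Real.exp (a * r) * Real.exp (-(a * t)) * (g t ω - g r ω) ^ 2)) ∂P := by
        refine lintegral_congr fun ω => ?_
        have := hc ω
        rw [intervalIntegral.integral_of_le ht, ofReal_integral_eq_lintegral_ofReal]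
        · refine (Continuous.intervalIntegrable ?_ 0 t).1
          fun_prop
        · exact Eventually.of_forall fun r => mul_nonneg (hk r) (sq_nonneg _)
    _ = ∫⁻ r in Ioc 0 t, (∫⁻ ω, ENNReal.ofReal
        (a * Real.exp (a * r) * Real.exp (-(a * t)) * (g t ω - g r ω) ^ 2) ∂P) := by
        refine lintegral_lintegral_swap (Measurable.aemeasurable ?_)
        have h1 : Measurable fun p : Ω × ℝ => g t p.1 := (hm t).comp measurable_fst
        simp only [Function.uncurry_def]
        fun_prop
    _ ≤ ∫⁻ r in Ioc 0 t, ENNReal.ofReal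
        (m * (a * Real.exp (a * r) * Real.exp (-(a * t)) * (t - r))) := by
        refine setLIntegral_mono' measurableSet_Ioc fun r hr => ?_
        simp_rw [ENNReal.ofReal_mul (hk r)]
        rw [lintegral_const_mul' _ _ ENNReal.ofReal_ne_top,
          show m * (a * Real.exp (a * r) * Real.exp (-(a * t)) * (t - r)) =
            a * Real.exp (a * r) * Real.exp (-(a * t)) * (m * (t - r)) by ring,
          ENNReal.ofReal_mul (hk r)]
        gcongr
        exact hinc r (Ioc_subset_Icc_self hr)
    _ = ENNReal.ofReal (m * ∫ r in (0 : ℝ)..t,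
        (a * Real.exp (a * r) * Real.exp (-(a * t)) * (t - r))) := by
        rw [← intervalIntegral.integral_const_mul, intervalIntegral.integral_of_le ht,
          ofReal_integral_eq_lintegral_ofReal]
        · exact (Continuous.intervalIntegrable (by fun_prop) 0 t).1
        · refine (ae_restrict_iff' measurableSet_Ioc).2 (Eventually.of_forall fun r hr => ?_)
          exact mul_nonneg hm0 (mul_nonneg (hk r) (sub_nonneg.2 hr.2))
    _ ≤ _ := by
        refine ENNReal.ofReal_le_ofReal ?_
        rw [div_eq_mul_one_div]
        exact mul_le_mul_of_nonneg_left (integral_expKernel_mul_sub_le ha ht) hm0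

/-- The factor 3 comes from squaring a sum of three terms; one `m / a` comes from the boundary term
`e^{-at} g t`, the other from the increments. -/
lemma lintegral_sq_ouPath_le [IsProbabilityMeasure P] {g : ℝ → Ω → ℝ}
    (hc : ∀ ω, Continuous fun t => g t ω)
    (hm : ∀ t, Measurable (g t)) {a m t : ℝ} (z : ℝ) (ha : 0 < a) (hm0 : 0 ≤ m) (ht : 0 ≤ t)
    (h0 : ∫⁻ ω, ENNReal.ofReal (g t ω ^ 2) ∂P ≤ ENNReal.ofReal (m * t))
    (hinc : ∀ r ∈ Icc 0 t, ∫⁻ ω, ENNReal.ofReal ((g t ω - g r ω) ^ 2) ∂P ≤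
      ENNReal.ofReal (m * (t - r))) :
    ∫⁻ ω, ENNReal.ofReal (ouPath a z (fun r => g r ω) t ^ 2) ∂P ≤
      ENNReal.ofReal (3 * (Real.exp (-(a * t)) ^ 2 * z ^ 2 + 2 * (m / a))) := by
  have hA : 0 ≤ Real.exp (-(a * t)) ^ 2 * z ^ 2 := by positivity
  have hma : 0 ≤ m / a := by positivity
  have hI : ∀ ω, 0 ≤ ∫ r in (0 : ℝ)..t,
      a * Real.exp (a * r) * Real.exp (-(a * t)) * (g t ω - g r ω) ^ 2 := fun ω =>
    intervalIntegral.integral_nonneg ht fun r _ => by positivity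
  have h1 : ∫⁻ ω, ENNReal.ofReal (Real.exp (-(a * t)) ^ 2 * g t ω ^ 2) ∂P ≤
      ENNReal.ofReal (m / a) := by
    simp_rw [ENNReal.ofReal_mul (sq_nonneg (Real.exp (-(a * t))))]
    rw [lintegral_const_mul _ ((hm t).pow_const 2).ennreal_ofReal]
    calc _ ≤ ENNReal.ofReal (Real.exp (-(a * t)) ^ 2) * ENNReal.ofReal (m * t) := by gcongr
      _ = ENNReal.ofReal (m * (Real.exp (-(a * t)) ^ 2 * t)) := by
          rw [← ENNReal.ofReal_mul (sq_nonneg _)]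
          congr 1
          ring
      _ ≤ _ := by
          refine ENNReal.ofReal_le_ofReal ?_
          rw [div_eq_mul_one_div]
          exact mul_le_mul_of_nonneg_left (mul_sq_exp_neg_le ha ht) hm0
  calc _ ≤ ∫⁻ ω, ENNReal.ofReal 3 * (ENNReal.ofReal (Real.exp (-(a * t)) ^ 2 * z ^ 2) +
        (ENNReal.ofReal (Real.exp (-(a * t)) ^ 2 * g t ω ^ 2) +
        ENNReal.ofReal (∫ r in (0 : ℝ)..t,
          a * Real.exp (a * r) * Real.exp (-(a * t)) * (g t ω - g r ω) ^ 2))) ∂P := by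
        refine lintegral_mono fun ω => ?_
        rw [← ENNReal.ofReal_add (by positivity) (hI ω),
          ← ENNReal.ofReal_add hA (add_nonneg (by positivity) (hI ω)),
          ← ENNReal.ofReal_mul (by norm_num), ← add_assoc]
        exact ENNReal.ofReal_le_ofReal (sq_ouPath_le ha (hc ω) ht)
    _ ≤ ENNReal.ofReal 3 * (ENNReal.ofReal (Real.exp (-(a * t)) ^ 2 * z ^ 2) +
        (ENNReal.ofReal (m / a) + ENNReal.ofReal (m / a))) := by
        rw [lintegral_const_mul' _ _ ENNReal.ofReal_ne_top, lintegral_add_left measurable_const,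
          lintegral_add_left (((hm t).pow_const 2).const_mul _).ennreal_ofReal]
        gcongr
        · simp
        · exact lintegral_weighted_increments_le hc hm ha hm0 ht hinc
    _ = _ := by
        rw [← ENNReal.ofReal_add hma hma, ← ENNReal.ofReal_add hA (by positivity),
          ← ENNReal.ofReal_mul (by norm_num), two_mul]

lemma stronglyMeasurable_ouPath {m : MeasurableSpace Ω} {g : ℝ → Ω → ℝ}
    (hc : ∀ ω, Continuous fun t => g t ω) {t : ℝ} (ht : 0 ≤ t)
    (hm : ∀ r ∈ Icc 0 t, StronglyMeasurable[m] (g r)) (a z : ℝ) :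
    StronglyMeasurable[m] fun ω => ouPath a z (fun r => g r ω) t := by
  -- Clamping time to `[0,t]` keeps the future of `g` out, so joint measurability holds over the
  -- σ-algebra `m` alone; this yields adaptedness.
  have hj : StronglyMeasurable[Prod.instMeasurableSpace]
      (Function.uncurry fun (r : ℝ) ω => g (projIcc 0 t ht r) ω) :=
    stronglyMeasurable_uncurry_of_continuous_of_stronglyMeasurable
      (fun ω => (hc ω).comp (continuous_subtype_val.comp continuous_projIcc))
      fun r => hm _ (Subtype.prop _)
  have hI : StronglyMeasurable fun ω => ∫ r in Ioc 0 t,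
      a * Real.exp (a * r) * g (projIcc 0 t ht r) ω := by
    refine StronglyMeasurable.integral_prod_left
      (f := fun r ω => a * Real.exp (a * r) * g (projIcc 0 t ht r) ω) ?_
    have hk : Continuous fun r : ℝ => a * Real.exp (a * r) := by fun_prop
    exact (hk.stronglyMeasurable.comp_measurable measurable_fst).mul hj
  have e : (fun ω => ouPath a z (fun r => g r ω) t) = fun ω => Real.exp (-(a * t)) *
      (z - ∫ r in Ioc 0 t, a * Real.exp (a * r) * g (projIcc 0 t ht r) ω) + g t ω := by
    ext ω
    rw [ouPath, intervalIntegral.integral_of_le ht]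
    congr 3
    refine setIntegral_congr_fun measurableSet_Ioc fun r hr => ?_
    simp only [projIcc_of_mem ht (Ioc_subset_Icc_self hr)]
  rw [e]
  exact ((stronglyMeasurable_const.sub hI).const_mul _).add (hm t ⟨ht, le_rfl⟩)

/-- A process whose paths are continuous almost surely agrees on `[0,T]`, outside a null set, with
an adapted process all of whose paths are continuous. -/
lemma exists_continuous_modification {F : Filtration ℝ mΩ} {T : ℝ} (hT : 0 ≤ T)
    (hF : IsNormalFiltration F T P) {g : ℝ → Ω → ℝ} (hg : IsAdaptedOn F T g)
    (hc : ∀ᵐ ω ∂P, ContinuousOn (fun t => g t ω) (Icc 0 T)) :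
    ∃ g' : ℝ → Ω → ℝ, (∀ ω, Continuous fun t => g' t ω) ∧ (∀ t, Measurable (g' t)) ∧
      IsAdaptedOn F T g' ∧ ∀ᵐ ω ∂P, ∀ t ∈ Icc 0 T, g' t ω = g t ω := by
  -- The set of discontinuous paths need not be measurable, so it is enlarged to a measurable null
  -- set. Normality puts that set in `F 0`, and zeroing the paths on it preserves adaptedness.
  set N := toMeasurable P {ω | ¬ ContinuousOn (fun t => g t ω) (Icc 0 T)} with hN
  have hNm : MeasurableSet N := measurableSet_toMeasurable _ _
  have hN0 : P N = 0 := by rw [hN, measure_toMeasurable]; exact hc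
  have hsub : ∀ ω ∈ Nᶜ, ContinuousOn (fun t => g t ω) (Icc 0 T) := fun ω hω => by
    by_contra h
    exact hω (subset_toMeasurable _ _ h)
  have hF0 : MeasurableSet[F 0] Nᶜ := (hF.null N hNm hN0).compl
  have hsm : ∀ t, StronglyMeasurable[F (projIcc 0 T hT t)]
      (Nᶜ.indicator (g (projIcc 0 T hT t))) := fun t =>
    (hg _ (Subtype.prop _)).indicator (F.mono (projIcc 0 T hT t).2.1 _ hF0)
  refine ⟨fun t => Nᶜ.indicator (g (projIcc 0 T hT t)), fun ω => ?_, fun t => ?_, fun t ht => ?_, ?_⟩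
  · by_cases hω : ω ∈ Nᶜ
    · simp only [indicator_of_mem hω]
      exact (hsub ω hω).comp_continuous (continuous_subtype_val.comp continuous_projIcc)
        fun t => Subtype.prop _
    · simp only [indicator_of_notMem hω]
      exact continuous_const
  · exact ((hsm t).mono (F.le _)).measurable
  · have e : (projIcc 0 T hT t : ℝ) = t := by rw [projIcc_of_mem hT ht]
    have h := hsm t
    rw [e] at h
    simpa only [e] using h
  · filter_upwards [compl_mem_ae_iff.2 hN0] with ω hω t ht
    rw [indicator_of_mem hω, projIcc_of_mem hT ht]

end Noise

lemma lintegral_sq_of_hasLaw_gaussianReal {Ω : Type*} {mΩ : MeasurableSpace Ω} {P : Measure Ω}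
    {X : Ω → ℝ} {v : ℝ≥0} (hX : HasLaw X (gaussianReal 0 v) P) :
    ∫⁻ ω, ENNReal.ofReal (X ω ^ 2) ∂P = v := by
  rw [hX.lintegral_comp (f := fun x => ENNReal.ofReal (x ^ 2)) (by fun_prop),
    ← ofReal_integral_eq_lintegral_ofReal]
  · have h := variance_id_gaussianReal (μ := 0) (v := v)
    rw [variance_of_integral_eq_zero (by fun_prop) (by simp)] at h
    simp only [id] at h
    rw [h, ENNReal.ofReal_coe_nnreal]
  · exact (memLp_id_gaussianReal (μ := 0) (v := v) 2).integrable_sq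
  · exact Eventually.of_forall fun x => sq_nonneg x

/-! ### The scalar solutions driven by the coordinates of `W`. -/

section Hilbert

variable {H : Type*} [NormedAddCommGroup H] [InnerProductSpace ℝ H]
  {L : H →ₗ.[ℝ] H} {S : EigenSystem L} {Q : H →L[ℝ] H} {mu : ℕ → ℝ}
  {Ω : Type*} {mΩ : MeasurableSpace Ω} {P : Measure Ω} {F : Filtration ℝ mΩ} {T : ℝ}
  {W : ℝ → Ω → H} {s ε : ℝ} {y₀ : H}

lemma EigenSystem.inner_self_e (S : EigenSystem L) (j : ℕ) : ⟪S.e j, S.e j⟫_ℝ = 1 := by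
  rw [real_inner_self_eq_norm_sq, S.e.orthonormal.1 j, one_pow]

lemma IsDiagonalCovariance.inner_eq (hQ : IsDiagonalCovariance S Q mu) (j : ℕ) :
    ⟪Q (S.e j), S.e j⟫_ℝ = mu j := by
  rw [hQ.eigen, real_inner_smul_left, S.inner_self_e, mul_one]

lemma IsDiagonalCovariance.mu_nonneg (hQ : IsDiagonalCovariance S Q mu) (j : ℕ) : 0 ≤ mu j := by
  rw [← hQ.inner_eq]
  exact hQ.isPositive.inner_nonneg_left _

lemma IsDiagonalCovariance.summable_mu (hQ : IsDiagonalCovariance S Q mu) : Summable mu :=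
  hQ.trace.congr hQ.inner_eq

/-- Equality holds when `√μ_j ≠ 0`; otherwise the left side is `0`. The inequality covers both
cases. -/
lemma sq_sub_brownianCoord_le (j : ℕ) (t r : ℝ) (ω : Ω) :
    (Real.sqrt (mu j) * brownianCoord S mu W j t ω -
      Real.sqrt (mu j) * brownianCoord S mu W j r ω) ^ 2 ≤ ⟪W t ω - W r ω, S.e j⟫_ℝ ^ 2 := by
  simp only [brownianCoord, inner_sub_left]
  by_cases h : Real.sqrt (mu j) = 0
  · simp only [h, zero_mul, sub_self, zero_pow two_ne_zero]
    exact sq_nonneg _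
  · rw [mul_inv_cancel_left₀ h, mul_inv_cancel_left₀ h]

variable [MeasurableSpace H] [BorelSpace H]

lemma lintegral_sq_sub_brownianCoord_le (hQ : IsDiagonalCovariance S Q mu)
    (hW : IsQWiener Q T P W) (j : ℕ) {r t : ℝ} (hr : 0 ≤ r) (hrt : r ≤ t) (ht : t ≤ T) :
    ∫⁻ ω, ENNReal.ofReal ((Real.sqrt (mu j) * brownianCoord S mu W j t ω -
      Real.sqrt (mu j) * brownianCoord S mu W j r ω) ^ 2) ∂P ≤
      ENNReal.ofReal (mu j * (t - r)) := by
  have h := lintegral_sq_of_hasLaw_gaussianReal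
    (hW.gaussian r ⟨hr, hrt.trans ht⟩ t ⟨hr.trans hrt, ht⟩ hrt (S.e j))
  rw [hQ.inner_eq, mul_comm] at h
  refine le_trans (lintegral_mono fun ω => ?_) h.le
  exact ENNReal.ofReal_le_ofReal (sq_sub_brownianCoord_le j t r ω)

/-- The coordinate noise `μ_j^{1/2} B_j` has a modification with continuous paths, whose increments
have the variance bound of a Brownian motion. -/
lemma exists_continuous_noise (hT : 0 ≤ T) (hF : IsNormalFiltration F T P)
    (hQ : IsDiagonalCovariance S Q mu) (hW : IsQWiener Q T P W) (hWF : IsAdaptedOn F T W) (j : ℕ) :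
    ∃ g : ℝ → Ω → ℝ, (∀ ω, Continuous fun t => g t ω) ∧ (∀ t, Measurable (g t)) ∧
      IsAdaptedOn F T g ∧
      (∀ᵐ ω ∂P, ∀ t ∈ Icc 0 T, g t ω = Real.sqrt (mu j) * brownianCoord S mu W j t ω) ∧
      (∀ t ∈ Icc 0 T, ∫⁻ ω, ENNReal.ofReal (g t ω ^ 2) ∂P ≤ ENNReal.ofReal (mu j * t)) ∧
      ∀ t ∈ Icc 0 T, ∀ r ∈ Icc 0 t, ∫⁻ ω, ENNReal.ofReal ((g t ω - g r ω) ^ 2) ∂P ≤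
        ENNReal.ofReal (mu j * (t - r)) := by
  obtain ⟨g, hgc, hgm, hga, hg⟩ := exists_continuous_modification hT hF
    (g := fun t ω => Real.sqrt (mu j) * brownianCoord S mu W j t ω)
    (fun t ht => (((hWF t ht).inner stronglyMeasurable_const).const_mul _).const_mul _)
    (by
      filter_upwards [hW.cont] with ω hω
      simp only [brownianCoord]
      exact continuousOn_const.mul (continuousOn_const.mul (hω.inner continuousOn_const)))
  have hinc : ∀ t ∈ Icc 0 T, ∀ r ∈ Icc 0 t, ∫⁻ ω, ENNReal.ofReal ((g t ω - g r ω) ^ 2) ∂P ≤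
      ENNReal.ofReal (mu j * (t - r)) := fun t ht r hr => by
    refine le_trans (le_of_eq (lintegral_congr_ae ?_))
      (lintegral_sq_sub_brownianCoord_le hQ hW j hr.1 hr.2 ht.2)
    filter_upwards [hg] with ω hω
    rw [hω t ht, hω r ⟨hr.1, hr.2.trans ht.2⟩]
  refine ⟨g, hgc, hgm, hga, hg, fun t ht => ?_, hinc⟩
  have h := hinc t ht 0 ⟨le_rfl, ht.1⟩
  rw [sub_zero] at h
  refine le_trans (le_of_eq (lintegral_congr_ae ?_)) h
  filter_upwards [hg, hW.zero] with ω hω h0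
  rw [hω 0 ⟨le_rfl, hT⟩]
  simp [brownianCoord, h0]

lemma exists_isItoSolution (hT : 0 ≤ T) (hF : IsNormalFiltration F T P)
    (hQ : IsDiagonalCovariance S Q mu) (hW : IsQWiener Q T P W) (hWF : IsAdaptedOn F T W) (j : ℕ)
    (a z : ℝ) :
    ∃ Z, IsItoSolution F T P (brownianCoord S mu W j) a (Real.sqrt (mu j)) z Z := by
  obtain ⟨g, hgc, -, hga, hg, -, -⟩ := exists_continuous_noise hT hF hQ hW hWF j
  refine ⟨fun t ω => ouPath a z (fun r => g r ω) t, fun t ht => ?_, ?_⟩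
  · exact stronglyMeasurable_ouPath hgc ht.1 (fun r hr =>
      (hga r ⟨hr.1, hr.2.trans ht.2⟩).mono (F.mono hr.2)) a z
  · filter_upwards [hg] with ω hω
    refine ⟨(continuous_ouPath (hgc ω)).continuousOn, fun t ht => ?_⟩
    rw [← hω t ht]
    exact ouPath_equation (hgc ω) t

/-- By pathwise uniqueness any solution is almost surely the explicit one driven by the continuous
modification, so the explicit bound transfers. -/
lemma IsItoSolution.lintegral_sq_le [IsProbabilityMeasure P] (hF : IsNormalFiltration F T P)
    (hQ : IsDiagonalCovariance S Q mu) (hW : IsQWiener Q T P W) (hWF : IsAdaptedOn F T W) {j : ℕ}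
    {a z : ℝ} (ha : 0 < a) {Z : ℝ → Ω → ℝ}
    (hZ : IsItoSolution F T P (brownianCoord S mu W j) a (Real.sqrt (mu j)) z Z)
    {t : ℝ} (ht : t ∈ Icc 0 T) :
    ∫⁻ ω, ENNReal.ofReal (Z t ω ^ 2) ∂P ≤
      ENNReal.ofReal (3 * (Real.exp (-(a * t)) ^ 2 * z ^ 2 + 2 * (mu j / a))) := by
  obtain ⟨g, hgc, hgm, -, hg, hg0, hginc⟩ :=
    exists_continuous_noise (ht.1.trans ht.2) hF hQ hW hWF j
  refine le_trans (le_of_eq (lintegral_congr_ae ?_))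
    (lintegral_sq_ouPath_le hgc hgm z ha (hQ.mu_nonneg j) ht.1 (hg0 t ht) (hginc t ht))
  filter_upwards [hg, hZ.equation] with ω hω hZω
  rw [eq_ouPath (hgc ω) hZω.1 (fun u hu => by rw [hω u hu]; exact hZω.2 u hu) t ht]

end Hilbert

/-! ### Series in the eigenbasis and summability of the moment bounds. -/

section Sums

variable {H : Type*} [NormedAddCommGroup H] [InnerProductSpace ℝ H]
  {L : H →ₗ.[ℝ] H} {S : EigenSystem L} {mu : ℕ → ℝ} {s ε : ℝ}

lemma summable_of_tsum_ofReal_lt_top {f : ℕ → ℝ} (hf : ∀ j, 0 ≤ f j)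
    (h : ∑' j, ENNReal.ofReal (f j) < ∞) : Summable f := by
  have := ENNReal.summable_toReal h.ne
  simpa only [ENNReal.toReal_ofReal (hf _)] using this

lemma tsum_lintegral_lt_top {Ω : Type*} {mΩ : MeasurableSpace Ω} {P : Measure Ω} {f : ℕ → Ω → ℝ}
    (hf : ∀ j, AEMeasurable (f j) P) {c : ℕ → ℝ} (hc0 : ∀ j, 0 ≤ c j) (hc : Summable c)
    (h : ∀ j, ∫⁻ ω, ENNReal.ofReal (f j ω) ∂P ≤ ENNReal.ofReal (c j)) :
    ∫⁻ ω, ∑' j, ENNReal.ofReal (f j ω) ∂P < ∞ := by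
  rw [lintegral_tsum fun j => (hf j).ennreal_ofReal]
  refine (ENNReal.tsum_le_tsum h).trans_lt ?_
  rw [← ENNReal.ofReal_tsum_of_nonneg hc0 hc]
  exact ENNReal.ofReal_lt_top

lemma EigenSystem.summable_inner_sq (S : EigenSystem L) (y : H) :
    Summable fun j => ⟪y, S.e j⟫_ℝ ^ 2 := by
  refine ((S.e.summable_inner_mul_inner y y)).congr fun j => ?_
  rw [real_inner_comm y, sq]

lemma EigenSystem.hasSum_of_summable_sq [CompleteSpace H] (S : EigenSystem L) {c : ℕ → ℝ}
    (hc : Summable fun j => c j ^ 2) : HasSum (fun j => c j • S.e j) (∑' j, c j • S.e j) := by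
  have hm : Memℓp c 2 := memℓp_gen (hc.congr fun j => by simp)
  exact (S.e.hasSum_repr_symm ⟨c, hm⟩).summable.hasSum

lemma EigenSystem.inner_eq_of_hasSum (S : EigenSystem L) {c : ℕ → ℝ} {y : H}
    (h : HasSum (fun j => c j • S.e j) y) (j : ℕ) : ⟪y, S.e j⟫_ℝ = c j := by
  have h1 := h.mapL (innerSL ℝ (S.e j))
  have h2 : HasSum (fun i => ⟪S.e j, c i • S.e i⟫_ℝ) (c j) := by
    convert hasSum_single j fun i hi => ?_
    · rw [real_inner_smul_right, S.inner_self_e, mul_one]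
    · rw [real_inner_smul_right, S.e.orthonormal.2 (Ne.symm hi), mul_zero]
  rw [real_inner_comm]
  exact h1.unique h2

lemma EigenSystem.rpow_two_mul (S : EigenSystem L) (s : ℝ) (j : ℕ) :
    S.lam j ^ (2 * s) = (S.lam j ^ s) ^ 2 := by
  rw [mul_comm, Real.rpow_mul (S.lam_pos j).le, Real.rpow_two]

/-- The exponents add up to `-s - ε ≤ -s`, and eventually `λ_j ≥ 1`. -/
lemma DecayAssumption.summable_rpow_mul (h : DecayAssumption S mu s ε) (hε : 0 ≤ ε) :
    Summable fun j => S.lam j ^ s * mu j := by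
  refine summable_of_isBigO_nat h.summable ?_
  refine ((Asymptotics.isBigO_refl (fun j => S.lam j ^ s) atTop).mul h.comparable.1).trans ?_
  refine Asymptotics.IsBigO.of_bound 1 ?_
  filter_upwards [S.lam_tendsto.eventually_ge_atTop 1] with j hj
  rw [← Real.rpow_add (S.lam_pos j), one_mul,
    Real.norm_of_nonneg (Real.rpow_nonneg (S.lam_pos j).le _),
    Real.norm_of_nonneg (Real.rpow_nonneg (S.lam_pos j).le _)]
  exact Real.rpow_le_rpow_of_exponent_le hj (by linarith)

lemma summable_secondMoment_bound (hmu : ∀ j, 0 ≤ mu j) (hsum : Summable mu) (hs : 0 < s) (y : H)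
    {t : ℝ} (ht : 0 ≤ t) :
    Summable fun j => 3 * (Real.exp (-(S.lam j ^ s * t)) ^ 2 * ⟪y, S.e j⟫_ℝ ^ 2 +
      2 * (mu j / S.lam j ^ s)) := by
  refine Summable.mul_left 3 (Summable.add ?_ (Summable.mul_left 2 ?_))
  · refine (S.summable_inner_sq y).of_nonneg_of_le (fun j => by positivity) fun j => ?_
    have h1 : Real.exp (-(S.lam j ^ s * t)) ≤ 1 :=
      Real.exp_le_one_iff.2 (by have := Real.rpow_nonneg (S.lam_pos j).le s; nlinarith)
    exact mul_le_of_le_one_left (sq_nonneg _) (pow_le_one₀ (Real.exp_pos _).le h1)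
  · refine (hsum.mul_right (1 / S.lam 0 ^ s)).of_nonneg_of_le
      (fun j => div_nonneg (hmu j) (Real.rpow_nonneg (S.lam_pos j).le s)) fun j => ?_
    rw [div_eq_mul_one_div]
    exact mul_le_mul_of_nonneg_left (one_div_le_one_div_of_le (Real.rpow_pos_of_pos (S.lam_pos 0) s)
      (Real.rpow_le_rpow (S.lam_pos 0).le (S.lam_mono (Nat.zero_le j)) hs.le)) (hmu j)

lemma summable_weighted_secondMoment_bound (h : DecayAssumption S mu s ε) (hε : 0 ≤ ε) (y : H)
    {t : ℝ} (ht : 0 < t) :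
    Summable fun j => S.lam j ^ (2 * s) *
      (3 * (Real.exp (-(S.lam j ^ s * t)) ^ 2 * ⟪y, S.e j⟫_ℝ ^ 2 + 2 * (mu j / S.lam j ^ s))) := by
  have h1 : Summable fun j =>
      (S.lam j ^ s * Real.exp (-(S.lam j ^ s * t))) ^ 2 * ⟪y, S.e j⟫_ℝ ^ 2 := by
    refine ((S.summable_inner_sq y).mul_left ((1 / t) ^ 2)).of_nonneg_of_le
      (fun j => by positivity) fun j => ?_
    have ha := Real.rpow_pos_of_pos (S.lam_pos j) s
    refine mul_le_mul_of_nonneg_right (pow_le_pow_left₀ (by positivity) ?_ 2) (sq_nonneg _)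
    -- Smoothing: `a e^{-at} ≤ 1/t`, from `at ≤ e^{at}`.
    rw [le_div_iff₀ ht, mul_right_comm, Real.exp_neg, ← div_eq_mul_inv,
      div_le_one (Real.exp_pos _)]
    linarith [Real.add_one_le_exp (S.lam j ^ s * t)]
  refine ((h1.mul_left 3).add ((h.summable_rpow_mul hε).mul_left 6)).congr fun j => ?_
  have ha := Real.rpow_pos_of_pos (S.lam_pos j) s
  rw [S.rpow_two_mul]
  field_simp
  ring

end Sums

/-! ### Basis expansions in the norm of `ℋ^s`. -/

namespace Hs

variable {H : Type*} [NormedAddCommGroup H] [InnerProductSpace ℝ H]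
  {L : H →ₗ.[ℝ] H} {S : EigenSystem L} {s : ℝ}

lemma norm_sq_eq (v : Hs S s) : ‖v‖ ^ 2 = ∑' j, S.lam j ^ (2 * s) * ⟪incl v, S.e j⟫_ℝ ^ 2 := by
  rw [norm_eq, Real.sq_sqrt]
  exact tsum_nonneg fun j => mul_nonneg (Real.rpow_nonneg (S.lam_pos j).le _) (sq_nonneg _)

lemma norm_smul_eq (c : ℝ) (v : Hs S s) : ‖c • v‖ = |c| * ‖v‖ := by
  change ‖coord (c • v)‖ = |c| * ‖coord v‖
  rw [map_smul, norm_smul, Real.norm_eq_abs]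

instance : NormedSpace ℝ (Hs S s) where
  norm_smul_le c v := (norm_smul_eq c v).le

lemma isometry_coord : Isometry (coord : Hs S s → lp (fun _ : ℕ => ℝ) 2) :=
  AddMonoidHomClass.isometry_of_norm coord fun _ => rfl

lemma e_mem (S : EigenSystem L) (s : ℝ) (j : ℕ) : S.e j ∈ hsSubmodule S s := by
  refine summable_of_ne_finset_zero (s := {j}) fun i hi => ?_
  rw [Finset.mem_singleton] at hi
  rw [S.e.orthonormal.2 (Ne.symm hi)]
  simp

/-- The basis vector `e_j` as an element of `ℋ^s`. -/
noncomputable def basisVec (S : EigenSystem L) (s : ℝ) (j : ℕ) : Hs S s :=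
  (⟨S.e j, e_mem S s j⟩ : hsSubmodule S s)

lemma incl_basisVec (j : ℕ) : incl (basisVec S s j) = S.e j := rfl

lemma coord_smul_basisVec (c : ℝ) (j : ℕ) :
    coord (c • basisVec S s j) = lp.single 2 j (S.lam j ^ s * c) := by
  ext i
  rw [coord_apply, map_smul, incl_basisVec, real_inner_smul_left]
  by_cases h : i = j
  · subst h
    rw [S.inner_self_e, mul_one, lp.single_apply_self]
  · rw [S.e.orthonormal.2 (Ne.symm h), lp.single_apply_ne _ _ _ h, mul_zero, mul_zero]

/-- Transported by the isometry `coord`, this is the expansion of an `ℓ²` sequence into single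
entries. It serves to prove measurability of `ℋ^s`-valued maps. -/
lemma tendsto_sum_basisVec (v : Hs S s) :
    Tendsto (fun n => ∑ j ∈ Finset.range n, ⟪incl v, S.e j⟫_ℝ • basisVec S s j) atTop (𝓝 v) := by
  rw [isometry_coord.isEmbedding.isInducing.tendsto_nhds_iff]
  have h := (lp.hasSum_single (p := 2) (by simp) (coord v)).tendsto_sum_nat
  refine h.congr fun n => ?_
  simp only [Function.comp_apply, map_sum, coord_smul_basisVec, coord_apply]

end Hs

/-! ### From coordinates to the `H`-valued process. -/

section Hilbert

variable {H : Type*} [NormedAddCommGroup H] [InnerProductSpace ℝ H]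
  {L : H →ₗ.[ℝ] H} {S : EigenSystem L} {Q : H →L[ℝ] H} {mu : ℕ → ℝ}
  {Ω : Type*} {mΩ : MeasurableSpace Ω} {P : Measure Ω} {F : Filtration ℝ mΩ} {T : ℝ}
  {W : ℝ → Ω → H} {s ε : ℝ} {y₀ : H}

/-- A random series in the eigenbasis belongs to `L²(Ω, ℋ^s)` if the weighted sum of the second
moments of its coefficients converges. -/
lemma memL2Hs_of_hasSum {u : Ω → H} {X : ℕ → Ω → ℝ} (hX : ∀ j, AEMeasurable (X j) P)
    (hu : ∀ᵐ ω ∂P, HasSum (fun j => X j ω • S.e j) (u ω)) {c : ℕ → ℝ} (hc0 : ∀ j, 0 ≤ c j)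
    (hc : Summable fun j => S.lam j ^ (2 * s) * c j)
    (h : ∀ j, ∫⁻ ω, ENNReal.ofReal (X j ω ^ 2) ∂P ≤ ENNReal.ofReal (c j)) :
    MemL2Hs S s P u := by
  classical
  have hl : ∀ j, 0 ≤ S.lam j ^ (2 * s) := fun j => Real.rpow_nonneg (S.lam_pos j).le _
  have hfin : ∫⁻ ω, ∑' j, ENNReal.ofReal (S.lam j ^ (2 * s) * X j ω ^ 2) ∂P < ∞ := by
    refine tsum_lintegral_lt_top (fun j => ((hX j).pow_const 2).const_mul _)
      (fun j => mul_nonneg (hl j) (hc0 j)) hc fun j => ?_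
    simp_rw [ENNReal.ofReal_mul (hl j)]
    rw [lintegral_const_mul' _ _ ENNReal.ofReal_ne_top]
    gcongr
    exact h j
  have hae : ∀ᵐ ω ∂P, ∑' j, ENNReal.ofReal (S.lam j ^ (2 * s) * X j ω ^ 2) < ∞ :=
    ae_lt_top' (AEMeasurable.tsum fun j =>
      (((hX j).pow_const 2).const_mul _).ennreal_ofReal) hfin.ne
  let z : Ω → Hs S s := fun ω =>
    if hω : u ω ∈ hsSubmodule S s then (⟨u ω, hω⟩ : hsSubmodule S s) else 0
  have hz : ∀ᵐ ω ∂P, Hs.incl (z ω) = u ω ∧ ∀ j, ⟪Hs.incl (z ω), S.e j⟫_ℝ = X j ω := by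
    filter_upwards [hu, hae] with ω hω hs
    have hmem : u ω ∈ hsSubmodule S s := by
      refine (summable_of_tsum_ofReal_lt_top
        (fun j => mul_nonneg (hl j) (sq_nonneg _)) hs).congr fun j => ?_
      rw [S.inner_eq_of_hasSum hω]
    have hzu : Hs.incl (z ω) = u ω := by
      have hzω : z ω = (⟨u ω, hmem⟩ : hsSubmodule S s) := dif_pos hmem
      rw [hzω]
      rfl
    exact ⟨hzu, fun j => by rw [hzu, S.inner_eq_of_hasSum hω]⟩
  refine ⟨z, ⟨?_, ?_⟩, hz.mono fun ω hω => hω.1⟩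
  -- Measurability is needed for the stronger `ℋ^s` topology, so `z` is exhibited as an almost sure
  -- limit of finite sums with scalar measurable coefficients.
  · refine aestronglyMeasurable_of_tendsto_ae atTop
      (f := fun n ω => ∑ j ∈ Finset.range n, X j ω • Hs.basisVec S s j) (fun n => ?_) ?_
    · exact Finset.aestronglyMeasurable_fun_sum _ fun j _ =>
        (hX j).aestronglyMeasurable.smul_const _
    · filter_upwards [hz] with ω hω
      simpa only [hω.2] using Hs.tendsto_sum_basisVec (z ω)
  · rw [eLpNorm_lt_top_iff_lintegral_rpow_enorm_lt_top two_ne_zero ENNReal.ofNat_ne_top]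
    refine lt_of_eq_of_lt (lintegral_congr_ae ?_) hfin
    filter_upwards [hz] with ω hω
    rw [← ENNReal.ofReal_tsum_of_nonneg (fun j => mul_nonneg (hl j) (sq_nonneg _))
      (by simpa only [hω.2] using Hs.summable_coord (z ω)), ENNReal.toReal_ofNat,
      ENNReal.rpow_ofNat, ← ofReal_norm, ← ENNReal.ofReal_pow (norm_nonneg _),
      Hs.norm_sq_eq]
    simp only [hω.2]

/-- A random series in the eigenbasis, summed where its coefficients are square-summable, is
measurable. -/
lemma stronglyMeasurable_indicator_tsum [CompleteSpace H] {m : MeasurableSpace Ω}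
    {X : ℕ → Ω → ℝ} (hX : ∀ j, StronglyMeasurable[m] (X j)) :
    StronglyMeasurable[m] ({ω | ∑' j, ENNReal.ofReal (X j ω ^ 2) < ∞}.indicator
      fun ω => ∑' j, X j ω • S.e j) := by
  have hG : MeasurableSet[m] {ω | ∑' j, ENNReal.ofReal (X j ω ^ 2) < ∞} :=
    measurableSet_lt (Measurable.tsum fun j =>
      ((hX j).measurable.pow_const 2).ennreal_ofReal) measurable_const
  refine stronglyMeasurable_of_tendsto atTop
    (f := fun n => {ω | ∑' j, ENNReal.ofReal (X j ω ^ 2) < ∞}.indicator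
      fun ω => ∑ j ∈ Finset.range n, X j ω • S.e j) (fun n => ?_) (tendsto_pi_nhds.2 fun ω => ?_)
  · exact (Finset.stronglyMeasurable_fun_sum _ fun j _ => (hX j).smul_const _).indicator hG
  · by_cases hω : ∑' j, ENNReal.ofReal (X j ω ^ 2) < ∞
    · simp only [indicator_of_mem (show ω ∈ {ω | ∑' j, ENNReal.ofReal (X j ω ^ 2) < ∞} from hω)]
      exact (S.hasSum_of_summable_sq
        (summable_of_tsum_ofReal_lt_top (fun j => sq_nonneg _) hω)).tendsto_sum_nat
    · simp only [indicator_of_notMem (show ω ∉ {ω | ∑' j, ENNReal.ofReal (X j ω ^ 2) < ∞} from hω)]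
      exact tendsto_const_nhds

variable [MeasurableSpace H] [BorelSpace H]

/-- The state equation has a solution. -/
theorem exists_isSolution [CompleteSpace H] [IsProbabilityMeasure P] (hT : 0 ≤ T)
    (hF : IsNormalFiltration F T P) (hQ : IsDiagonalCovariance S Q mu) (hW : IsQWiener Q T P W)
    (hWF : IsAdaptedOn F T W) (hs : 0 < s) (y₀ : H) :
    ∃ y : ℝ → Ω → H, IsSolution S mu F T P W s y₀ y := by
  choose Y hY using fun j =>
    exists_isItoSolution hT hF hQ hW hWF j (S.lam j ^ s) ⟪y₀, S.e j⟫_ℝ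
  -- The convergence event is itself `F t`-measurable, so setting the process to `0` off it keeps it
  -- adapted.
  refine ⟨fun t => {ω | ∑' j, ENNReal.ofReal (Y j t ω ^ 2) < ∞}.indicator
    fun ω => ∑' j, Y j t ω • S.e j,
    fun t ht => stronglyMeasurable_indicator_tsum fun j => (hY j).adapted t ht, Y, hY,
    fun t ht => ?_⟩
  have hm : ∀ j, Measurable fun ω => Y j t ω ^ 2 := fun j =>
    (((hY j).adapted t ht).mono (F.le t)).measurable.pow_const 2
  have hfin : ∫⁻ ω, ∑' j, ENNReal.ofReal (Y j t ω ^ 2) ∂P < ∞ :=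
    tsum_lintegral_lt_top (fun j => (hm j).aemeasurable)
      (fun j => by
        have := div_nonneg (hQ.mu_nonneg j) (Real.rpow_nonneg (S.lam_pos j).le s)
        positivity)
      (summable_secondMoment_bound hQ.mu_nonneg hQ.summable_mu hs y₀ ht.1)
      fun j => (hY j).lintegral_sq_le hF hQ hW hWF (Real.rpow_pos_of_pos (S.lam_pos j) s) ht
  filter_upwards [ae_lt_top (Measurable.tsum fun j => (hm j).ennreal_ofReal) hfin.ne]
    with ω hω
  rw [indicator_of_mem (by exact hω)]
  exact S.hasSum_of_summable_sq (summable_of_tsum_ofReal_lt_top (fun j => sq_nonneg _) hω)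

/-- Every solution is square integrable with values in `ℋ^s` at positive times. -/
theorem IsSolution.memL2Hs [IsProbabilityMeasure P] (hF : IsNormalFiltration F T P)
    (hQ : IsDiagonalCovariance S Q mu) (hW : IsQWiener Q T P W) (hWF : IsAdaptedOn F T W)
    (hε : 0 ≤ ε) (hdecay : DecayAssumption S mu s ε) {y : ℝ → Ω → H}
    (hy : IsSolution S mu F T P W s y₀ y) {t : ℝ} (ht : t ∈ Ioc 0 T) :
    MemL2Hs S s P (y t) := by
  have ht' : t ∈ Icc 0 T := Ioc_subset_Icc_self ht
  obtain ⟨Y, hY, hsum⟩ := hy.expansion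
  exact memL2Hs_of_hasSum
    (fun j => (((hY j).adapted t ht').mono (F.le t)).measurable.aemeasurable) (hsum t ht')
    (fun j => by
      have := div_nonneg (hQ.mu_nonneg j) (Real.rpow_nonneg (S.lam_pos j).le s)
      positivity)
    (summable_weighted_secondMoment_bound hdecay hε y₀ ht.1)
    fun j => (hY j).lintegral_sq_le hF hQ hW hWF (Real.rpow_pos_of_pos (S.lam_pos j) s) ht'

end Hilbert

end FracSPDE

theorem mainTheorem6 {E : Type*} [NormedAddCommGroup E] [NormedSpace ℝ E] [FiniteDimensional ℝ E]
    [MeasureSpace E] [BorelSpace E] [(volume : Measure E).IsAddHaarMeasure]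
    (D : Set E) (_hD : FracSPDE.IsBoundedDomain D)
    (L : FracSPDE.L2 D →ₗ.[ℝ] FracSPDE.L2 D) (_hL : FracSPDE.IsPosSelfAdjointCompactInv L)
    (S : FracSPDE.EigenSystem L)
    (Q : FracSPDE.L2 D →L[ℝ] FracSPDE.L2 D) (mu : ℕ → ℝ)
    (_hQ : FracSPDE.IsDiagonalCovariance S Q mu)
    {Ω : Type*} {mΩ : MeasurableSpace Ω} (P : Measure Ω) [IsProbabilityMeasure P]
    (T : ℝ) (_hT : 0 < T)
    (F : Filtration ℝ mΩ) (_hF : FracSPDE.IsNormalFiltration F T P)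
    (W : ℝ → Ω → FracSPDE.L2 D) (_hW : FracSPDE.IsQWiener Q T P W)
    (_hWF : FracSPDE.IsAdaptedOn F T W)
    (s : ℝ) (_hs : 0 < s) (ε : ℝ) (_hε : 0 ≤ ε) (_hdecay : FracSPDE.DecayAssumption S mu s ε)
    (y₀ : FracSPDE.L2 D) :
    (∃ y : ℝ → Ω → FracSPDE.L2 D, FracSPDE.IsSolution S mu F T P W s y₀ y) ∧
    ∀ y : ℝ → Ω → FracSPDE.L2 D, FracSPDE.IsSolution S mu F T P W s y₀ y →
      ∀ t ∈ Ioc 0 T, FracSPDE.MemL2Hs S s P (y t) :=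
  ⟨FracSPDE.exists_isSolution _hT.le _hF _hQ _hW _hWF _hs y₀,
    fun _ hy _ ht => hy.memL2Hs _hF _hQ _hW _hWF _hε _hdecay ht⟩
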